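/- Let $\mathfrak F$ be a nonempty closed subset of $\mathbb C$ with $\mathfrak F\neq\mathbb C$, and fix $z_0\in\mathfrak F$. For a complex Radon measure $\mu$ on $\mathbb C\setminus\mathfrak F$ (possibly of infinite total variation), with total variation measure $|\mu|$, put $$\|\mu\|_{\mathscr M(\mathbb C\setminus\mathfrak F)}=\sup_{z\in\mathfrak F}\int_{\mathbb C\setminus\mathfrak F}\frac{d|\mu|(\zeta)}{|\zeta-z|^2},$$ and let $\mathscr M(\mathbb C\setminus\mathfrak F)$ be the set of those $\mu$ for which this is finite. For such $\mu$ and $z\in\mathfrak F$ let $$\widehat\mu_{z_0}(z)=\int_{\mathbb C\setminus\mathfrak F}\Big(\frac1{\zeta-z}-\frac1{\zeta-z_0}\Big)\,d\mu(\zeta).$$ Let $\widehat{\mathscr M}(\mathfrak F)$ be the set of functions $f$ on $\mathfrak F$ of the form $f=c+\widehat\mu_{z_0}$ with $c\in\mathbb C$ and $\mu\in\mathscr M(\mathbb C\setminus\mathfrak F)$, and put $$\|f\|_{\widehat{\mathscr M}(\mathfrak F)}=\inf\{\|\mu\|_{\mathscr M(\mathbb C\setminus\mathfrak F)}:\ \mu\in\mathscr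 M(\mathbb C\setminus\mathfrak F),\ f-\widehat\mu_{z_0}\text{ is constant on }\mathfrak F\}.$$ A continuous function $f:\mathfrak F\to\mathbb C$ is called commutator Lipschitz if there is $C\ge0$ such that $$\|f(N)R-Rf(N)\|\le C\,\|NR-RN\|$$ for every bounded operator $R$ and every bounded normal operator $N$ with spectrum in $\mathfrak F$ on a complex Hilbert space. The set of these functions is denoted by $\mathrm{CL}(\mathfrak F)$, and the smallest such $C$ by $\|f\|_{\mathrm{CL}(\mathfrak F)}$. Then $$\widehat{\mathscr M}(\mathfrak F)\subset\mathrm{CL}(\mathfrak F)\qquad\text{and}\qquad\|f\|_{\mathrm{CL}(\mathfrak F)}\le\|f\|_{\widehat{\mathscr M}(\mathfrak F)}\quad\text{for every }f\in\widehat{\mathscr M}(\mathfrak F).$$ -/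

import Mathlib

open MeasureTheory
open scoped ENNReal NNReal

universe u

noncomputable section

/-- A complex Radon measure `μ` on `X`, possibly of infinite total variation, given by its polar
decomposition `dμ = phase d|μ|`: a positive Radon measure `variation = |μ|` and a measurable
function `phase` of modulus one. -/
structure ComplexRadonMeasure (X : Type*) [TopologicalSpace X] [MeasurableSpace X] where
  /-- the total variation measure `|μ|` -/
  variation : Measure X
  regular : variation.Regular
  /-- the density of `μ` with respect to `|μ|` -/
  phase : X → ℂ
  measurable_phase : Measurable phase
  norm_phase : ∀ x, ‖phase x‖ = 1

namespace ComplexRadonMeasure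

variable {X : Type*} [TopologicalSpace X] [MeasurableSpace X]

/-- The integral `∫ g dμ` of a `|μ|`-integrable function `g`. -/
def integral (μ : ComplexRadonMeasure X) (g : X → ℂ) : ℂ :=
  ∫ x, g x * μ.phase x ∂μ.variation

/-- The finite complex measure `E ↦ μ (E ∩ K)`, for compact `K`. -/
def onCompact (μ : ComplexRadonMeasure X) (K : Set X) : ComplexMeasure X :=
  (μ.variation.restrict K).withDensityᵥ μ.phase

/-- `variation` is the total variation: on each compact set it agrees with the supremum of
`∑ ‖μ (Eᵢ)‖` over finite partitions into Borel sets. -/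
theorem variation_onCompact (μ : ComplexRadonMeasure X) {K : Set X} (hK : IsCompact K) :
    (μ.onCompact K).variation = μ.variation.restrict K := by
  have := μ.regular
  have hfin : IsFiniteMeasure (μ.variation.restrict K) :=
    ⟨by simpa using hK.measure_lt_top⟩
  have hint : Integrable μ.phase (μ.variation.restrict K) :=
    Integrable.of_bound μ.measurable_phase.aestronglyMeasurable 1
      (Filter.Eventually.of_forall fun x => (μ.norm_phase x).le)
  have h1 : (fun x => ‖μ.phase x‖ₑ) = 1 := by
    funext x
    rw [← ofReal_norm, μ.norm_phase x]
    simp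
  rw [onCompact, Measure.variation_withDensityᵥ hint, h1, withDensity_one]

end ComplexRadonMeasure

/-- `‖μ‖ = sup_{z ∈ F} ∫_{ℂ ∖ F} d|μ|(ζ) / |ζ - z|²`, a value in `[0, ∞]`. -/
def cauchyWeightNorm (F : Set ℂ) (μ : ComplexRadonMeasure ↥Fᶜ) : ℝ≥0∞ :=
  ⨆ z ∈ F, ∫⁻ ζ : ↥Fᶜ, 1 / ‖(ζ : ℂ) - z‖ₑ ^ 2 ∂μ.variation

/-- The modified Cauchy integral `∫_{ℂ ∖ F} (1 / (ζ - z) - 1 / (ζ - z₀)) dμ(ζ)`. -/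
def modifiedCauchyIntegral (F : Set ℂ) (μ : ComplexRadonMeasure ↥Fᶜ) (z₀ z : ℂ) : ℂ :=
  μ.integral fun ζ : ↥Fᶜ => 1 / ((ζ : ℂ) - z) - 1 / ((ζ : ℂ) - z₀)

/-- `μ` has finite norm and `f` is, on `F`, a constant plus the modified Cauchy integral
of `μ`. -/
def IsCauchyRepresentation (F : Set ℂ) (z₀ : ℂ) (f : ℂ → ℂ) (μ : ComplexRadonMeasure ↥Fᶜ) :
    Prop :=
  cauchyWeightNorm F μ < ∞ ∧ ∃ c : ℂ, ∀ z ∈ F, f z = c + modifiedCauchyIntegral F μ z₀ z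

/-- The functions whose restriction to `F` is a constant plus a modified Cauchy integral, with
base point `z₀ ∈ F`. Functions on `F` are represented by functions on `ℂ`; only their values
on `F` matter. -/
def CauchyClass (F : Set ℂ) (z₀ : ℂ) : Set (ℂ → ℂ) :=
  {f | ∃ μ : ComplexRadonMeasure ↥Fᶜ, IsCauchyRepresentation F z₀ f μ}

/-- The infimum of the norms of the measures representing `f` (and `∞` if there are none). -/
def cauchyClassNorm (F : Set ℂ) (z₀ : ℂ) (f : ℂ → ℂ) : ℝ≥0∞ :=
  ⨅ (μ : ComplexRadonMeasure ↥Fᶜ) (_ : IsCauchyRepresentation F z₀ f μ), cauchyWeightNorm F μ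

/-- `f` is continuous on `F` and `‖f(N) R - R f(N)‖ ≤ C ‖N R - R N‖` for every bounded operator
`R` and every bounded normal operator `N` with spectrum in `F` on any complex Hilbert space;
`f(N)` is given by the continuous functional calculus. -/
def IsCommutatorLipschitzWith (F : Set ℂ) (C : ℝ≥0) (f : ℂ → ℂ) : Prop :=
  ContinuousOn f F ∧
    ∀ (H : Type u) [NormedAddCommGroup H] [InnerProductSpace ℂ H] [CompleteSpace H]
      (N R : H →L[ℂ] H), IsStarNormal N → spectrum ℂ N ⊆ F →
        ‖cfc f N * R - R * cfc f N‖ ≤ C * ‖N * R - R * N‖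

/-- The commutator Lipschitz functions on `F`. -/
def CommutatorLipschitz (F : Set ℂ) : Set (ℂ → ℂ) :=
  {f | ∃ C : ℝ≥0, IsCommutatorLipschitzWith.{u} F C f}

/-- The smallest commutator Lipschitz constant of `f` on `F`, and `∞` if `f` is not commutator
Lipschitz on `F`. -/
def commutatorLipschitzNorm (F : Set ℂ) (f : ℂ → ℂ) : ℝ≥0∞ :=
  ⨅ (C : ℝ≥0) (_ : IsCommutatorLipschitzWith.{u} F C f), (C : ℝ≥0∞)

end

/-! For `ζ ∉ F` the resolvent `G = (ζ - N)⁻¹` satisfies `[G, R] = G [N, R] G`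
(`cfc_cauchyKernel_sub_commutator`). Integrating against `μ`, weakly, gives `[f(N), R] = ∫ G [N, R]
G dμ(ζ)` (via `integrable_and_integral_inner_cfc`). Paired with unit vectors `u`, `v`, this is at
most `‖[N, R]‖ ∫ ‖G* v‖ ‖G u‖ d|μ|`, and `‖G* v‖ = ‖G v‖` by normality. Since `‖G u‖² = ∫ |ζ - z|⁻²
dν(z)` for the spectral measure `ν` of `u`, Tonelli gives `∫ ‖G u‖² d|μ| ≤ ‖μ‖ ‖u‖²`
(`lintegral_enorm_cfc_cauchyKernel_apply_sq_le`). Cauchy–Schwarz then yields the constant `‖μ‖`, and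
the infimum over representing `μ` is taken last. -/

/-! ### Scalar spectral measures of a normal operator. -/

section SpectralMeasure

open scoped InnerProductSpace CompactlySupported

variable {H : Type*} [NormedAddCommGroup H] [InnerProductSpace ℂ H] [CompleteSpace H]

/-- A real-valued continuous function, viewed as a complex-valued one. -/
def ContinuousMap.toComplex {X : Type*} [TopologicalSpace X] (φ : C(X, ℝ)) : C(X, ℂ) :=
  ⟨fun x => (φ x : ℂ), by fun_prop⟩

theorem cfcHom_toComplex_isSelfAdjoint {N : H →L[ℂ] H} (hN : IsStarNormal N)
    (φ : C(spectrum ℂ N, ℝ)) : IsSelfAdjoint (cfcHom (R := ℂ) hN φ.toComplex) := by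
  rw [IsSelfAdjoint, ← map_star]
  congr 1
  ext x
  simp [ContinuousMap.toComplex]

theorem inner_cfcHom_toComplex_nonneg {N : H →L[ℂ] H} (hN : IsStarNormal N)
    {φ : C(spectrum ℂ N, ℝ)} (hφ : ∀ x, 0 ≤ φ x) (u : H) :
    0 ≤ (⟪u, cfcHom (R := ℂ) hN φ.toComplex u⟫_ℂ).re := by
  let s : C(spectrum ℂ N, ℝ) := ⟨fun x => √(φ x), by fun_prop⟩
  have hs : φ.toComplex = s.toComplex * s.toComplex := by
    ext x
    simp [ContinuousMap.toComplex, s, ← Complex.ofReal_mul, Real.mul_self_sqrt (hφ x)]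
  have hsa := cfcHom_toComplex_isSelfAdjoint hN s
  rw [ContinuousLinearMap.isSelfAdjoint_iff'] at hsa
  rw [hs, map_mul, mul_apply_eq_comp, ← ContinuousLinearMap.adjoint_inner_left, hsa]
  exact inner_self_nonneg (𝕜 := ℂ)

/-- The scalar spectral measure of a normal operator at a vector. -/
theorem exists_scalar_spectralMeasure {N : H →L[ℂ] H} (hN : IsStarNormal N) (u : H) :
    ∃ ν : Measure (spectrum ℂ N), IsFiniteMeasure ν ∧
      ∀ g : ℂ → ℂ, ContinuousOn g (spectrum ℂ N) →
        ⟪u, cfc g N u⟫_ℂ = ∫ z, g z ∂ν := by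
  let Λ₀ : C_c(spectrum ℂ N, ℝ) →ₗ[ℝ] ℝ :=
    { toFun φ := (⟪u, cfcHom (R := ℂ) hN (φ : C(spectrum ℂ N, ℝ)).toComplex u⟫_ℂ).re
      map_add' φ ψ := by
        have : ((φ + ψ : C_c(spectrum ℂ N, ℝ)) : C(spectrum ℂ N, ℝ)).toComplex =
            (φ : C(spectrum ℂ N, ℝ)).toComplex + (ψ : C(spectrum ℂ N, ℝ)).toComplex := by
          ext x; simp [ContinuousMap.toComplex]
        rw [this, map_add, add_apply, inner_add_right, Complex.add_re]
      map_smul' r φ := by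
        have : ((r • φ : C_c(spectrum ℂ N, ℝ)) : C(spectrum ℂ N, ℝ)).toComplex =
            (r : ℂ) • (φ : C(spectrum ℂ N, ℝ)).toComplex := by
          ext x; simp [ContinuousMap.toComplex]
        rw [this, map_smul, smul_apply, inner_smul_right, Complex.re_ofReal_mul]
        simp }
  let Λ : C_c(spectrum ℂ N, ℝ) →ₚ[ℝ] ℝ :=
    PositiveLinearMap.mk₀ Λ₀ fun φ hφ => inner_cfcHom_toComplex_nonneg hN (fun x => hφ x) u
  have hfin : IsFiniteMeasureOnCompacts (RealRMK.rieszMeasure Λ) := inferInstance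
  have hfin' : IsFiniteMeasure (RealRMK.rieszMeasure Λ) :=
    ⟨isCompact_univ.measure_lt_top⟩
  have key (φ : C(spectrum ℂ N, ℝ)) : ⟪u, cfcHom (R := ℂ) hN φ.toComplex u⟫_ℂ =
      ((∫ z, φ z ∂(RealRMK.rieszMeasure Λ) : ℝ) : ℂ) := by
    have h1 := RealRMK.integral_rieszMeasure Λ
      (CompactlySupportedContinuousMap.continuousMapEquiv φ)
    have h2 : (⟪u, cfcHom (R := ℂ) hN φ.toComplex u⟫_ℂ).re =
      ∫ z, φ z ∂(RealRMK.rieszMeasure Λ) := h1.symm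
    -- Self-adjointness makes the inner product real, so taking real parts in `Λ₀` lost nothing.
    rw [← h2, eq_comm, ← Complex.conj_eq_iff_re, inner_conj_symm,
      ← ContinuousLinearMap.adjoint_inner_right,
      ContinuousLinearMap.isSelfAdjoint_iff'.mp (cfcHom_toComplex_isSelfAdjoint hN φ)]
  refine ⟨RealRMK.rieszMeasure Λ, hfin', fun g hg => ?_⟩
  rw [cfc_apply g N hN hg]
  set G : C(spectrum ℂ N, ℂ) := ⟨_, hg.domRestrict⟩
  let a : C(spectrum ℂ N, ℝ) := ⟨fun x => (G x).re, by fun_prop⟩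
  let b : C(spectrum ℂ N, ℝ) := ⟨fun x => (G x).im, by fun_prop⟩
  have hG : G = a.toComplex + Complex.I • b.toComplex := by
    ext x
    simp [ContinuousMap.toComplex, a, b, mul_comm Complex.I, Complex.re_add_im]
  have hint : Integrable (fun z => G z) (RealRMK.rieszMeasure Λ) :=
    G.continuous.integrable_of_hasCompactSupport (HasCompactSupport.of_compactSpace _)
  rw [hG, map_add, map_smul, add_apply, smul_apply,
    inner_add_right, inner_smul_right, key, key]
  change _ = ∫ z, G z ∂_
  rw [← integral_re_add_im hint]
  simp [a, b, mul_comm Complex.I]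

theorem enorm_cfc_apply_sq {N : H →L[ℂ] H} [IsStarNormal N] {u : H}
    {ν : Measure (spectrum ℂ N)} [IsFiniteMeasure ν]
    (hν : ∀ g : ℂ → ℂ, ContinuousOn g (spectrum ℂ N) → ⟪u, cfc g N u⟫_ℂ = ∫ z, g z ∂ν)
    {g : ℂ → ℂ} (hg : ContinuousOn g (spectrum ℂ N)) :
    ‖cfc g N u‖ₑ ^ 2 = ∫⁻ z, ‖g z‖ₑ ^ 2 ∂ν := by
  have h1 : ⟪u, cfc (fun z => star (g z) * g z) N u⟫_ℂ = ((‖cfc g N u‖ ^ 2 : ℝ) : ℂ) := by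
    rw [cfc_mul (fun z => star (g z)) g N hg.star hg, cfc_star, mul_apply_eq_comp,
      ContinuousLinearMap.star_eq_adjoint, ContinuousLinearMap.adjoint_inner_right,
      inner_self_eq_norm_sq_to_K]
    simp
  rw [hν (fun z => star (g z) * g z) (hg.star.mul hg)] at h1
  have h2 : ∫ z : spectrum ℂ N, ‖g z‖ ^ 2 ∂ν = ‖cfc g N u‖ ^ 2 := by
    rw [← Complex.ofReal_inj, ← h1, ← integral_complex_ofReal]
    refine integral_congr_ae (.of_forall fun z => ?_)
    simp [Complex.conj_mul']
  have hc : Continuous fun z : spectrum ℂ N => ‖g z‖ ^ 2 := (hg.domRestrict.norm.pow 2)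
  have h3 := ofReal_integral_eq_lintegral_ofReal (μ := ν)
    (hc.integrable_of_hasCompactSupport (HasCompactSupport.of_compactSpace _))
    (.of_forall fun z => by positivity)
  rw [h2] at h3
  simpa [ENNReal.ofReal_pow] using h3

/-- Spectral measures see only diagonal coefficients `⟪u, T u⟫`; this recovers the others. -/
theorem inner_polarization_right (T : H →L[ℂ] H) (x y : H) :
    ⟪x, T y⟫_ℂ = (⟪x + y, T (x + y)⟫_ℂ - ⟪x - y, T (x - y)⟫_ℂ -
      Complex.I * ⟪x + Complex.I • y, T (x + Complex.I • y)⟫_ℂ +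
      Complex.I * ⟪x - Complex.I • y, T (x - Complex.I • y)⟫_ℂ) / 4 := by
  simp only [← ContinuousLinearMap.adjoint_inner_left]
  exact inner_map_polarization' (ContinuousLinearMap.adjoint T : H →ₗ[ℂ] H) x y

end SpectralMeasure

/-! ### Cauchy kernels and the modified Cauchy integral on `F`. -/

section CauchyIntegral

open scoped InnerProductSpace

theorem lintegral_mul_le_of_lintegral_sq_le {α : Type*} [MeasurableSpace α] {m : Measure α}
    {f g : α → ℝ≥0∞} (hf : AEMeasurable f m) (hg : AEMeasurable g m) {M : ℝ≥0∞}
    (hfM : ∫⁻ a, f a ^ 2 ∂m ≤ M) (hgM : ∫⁻ a, g a ^ 2 ∂m ≤ M) :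
    ∫⁻ a, f a * g a ∂m ≤ M := by
  have h := ENNReal.lintegral_mul_le_Lp_mul_Lq m Real.HolderConjugate.two_two hf hg
  simp only [Pi.mul_apply, ENNReal.rpow_two] at h
  calc _ ≤ _ := h
    _ ≤ M ^ (1 / 2 : ℝ) * M ^ (1 / 2 : ℝ) := by gcongr
    _ = M := by
      rw [← ENNReal.rpow_add_of_nonneg _ _ (by norm_num) (by norm_num)]
      norm_num

variable {F : Set ℂ} {μ : ComplexRadonMeasure ↥Fᶜ}

theorem ComplexRadonMeasure.sigmaFinite_variation (hF : IsClosed F)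
    (μ : ComplexRadonMeasure ↥Fᶜ) : SigmaFinite μ.variation := by
  have := μ.regular
  have := hF.isOpen_compl.locallyCompactSpace
  have : IsLocallyFiniteMeasure μ.variation :=
    isLocallyFiniteMeasure_of_isFiniteMeasureOnCompacts
  infer_instance

theorem coe_compl_sub_ne_zero (ζ : ↥Fᶜ) {z : ℂ} (hz : z ∈ F) : (ζ : ℂ) - z ≠ 0 :=
  sub_ne_zero.mpr fun h => ζ.2 (h ▸ hz)

theorem lintegral_cauchyKernel_sq_le {z : ℂ} (hz : z ∈ F) :
    ∫⁻ ζ : ↥Fᶜ, ‖1 / ((ζ : ℂ) - z)‖ₑ ^ 2 ∂μ.variation ≤ cauchyWeightNorm F μ := by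
  refine le_trans (le_of_eq ?_) (le_iSup₂ (α := ℝ≥0∞) z hz)
  refine lintegral_congr fun ζ => ?_
  rw [one_div, enorm_inv (coe_compl_sub_ne_zero ζ hz), ← ENNReal.inv_pow, one_div]

theorem cauchyKernel_sub (ζ : ↥Fᶜ) {z w : ℂ} (hz : z ∈ F) (hw : w ∈ F) :
    1 / ((ζ : ℂ) - z) - 1 / ((ζ : ℂ) - w) =
      (z - w) * (1 / ((ζ : ℂ) - z) * (1 / ((ζ : ℂ) - w))) := by
  have h1 := coe_compl_sub_ne_zero ζ hz
  have h2 := coe_compl_sub_ne_zero ζ hw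
  field_simp
  ring

/-- The difference factors as `z - w` times a product of two kernels, each square-integrable for
`|μ|`, so Cauchy–Schwarz applies. Both convergence and the Lipschitz bound for the Cauchy integral
come from this. -/
theorem lintegral_cauchyKernel_sub_le {z w : ℂ} (hz : z ∈ F) (hw : w ∈ F) :
    ∫⁻ ζ : ↥Fᶜ, ‖1 / ((ζ : ℂ) - z) - 1 / ((ζ : ℂ) - w)‖ₑ ∂μ.variation ≤
      ‖z - w‖ₑ * cauchyWeightNorm F μ := by
  have hm (z : ℂ) : Measurable fun ζ : ↥Fᶜ => ‖1 / ((ζ : ℂ) - z)‖ₑ := by fun_prop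
  simp_rw [cauchyKernel_sub _ hz hw, enorm_mul]
  rw [lintegral_const_mul _ (by fun_prop)]
  gcongr
  exact lintegral_mul_le_of_lintegral_sq_le (hm z).aemeasurable (hm w).aemeasurable
    (lintegral_cauchyKernel_sq_le hz) (lintegral_cauchyKernel_sq_le hw)

theorem ComplexRadonMeasure.enorm_phase {X : Type*} [TopologicalSpace X] [MeasurableSpace X]
    (μ : ComplexRadonMeasure X) (x : X) : ‖μ.phase x‖ₑ = 1 := by
  rw [← ofReal_norm, μ.norm_phase x, ENNReal.ofReal_one]

theorem integrable_cauchyKernel_sub_mul_phase (hμ : cauchyWeightNorm F μ < ∞) {z w : ℂ}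
    (hz : z ∈ F) (hw : w ∈ F) :
    Integrable (fun ζ : ↥Fᶜ => (1 / ((ζ : ℂ) - z) - 1 / ((ζ : ℂ) - w)) * μ.phase ζ)
      μ.variation := by
  have := μ.measurable_phase
  refine ⟨by fun_prop, ?_⟩
  simp only [HasFiniteIntegral, enorm_mul, μ.enorm_phase, mul_one]
  exact (lintegral_cauchyKernel_sub_le hz hw).trans_lt (ENNReal.mul_lt_top (by simp) hμ)

theorem modifiedCauchyIntegral_sub (hμ : cauchyWeightNorm F μ < ∞) {z₀ z w : ℂ} (hz₀ : z₀ ∈ F)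
    (hz : z ∈ F) (hw : w ∈ F) :
    modifiedCauchyIntegral F μ z₀ z - modifiedCauchyIntegral F μ z₀ w =
      modifiedCauchyIntegral F μ w z := by
  simp only [modifiedCauchyIntegral, ComplexRadonMeasure.integral]
  rw [← integral_sub (integrable_cauchyKernel_sub_mul_phase hμ hz hz₀)
    (integrable_cauchyKernel_sub_mul_phase hμ hw hz₀)]
  refine integral_congr_ae (.of_forall fun ζ => ?_)
  ring

theorem enorm_modifiedCauchyIntegral_le {z w : ℂ} (hz : z ∈ F) (hw : w ∈ F) :
    ‖modifiedCauchyIntegral F μ w z‖ₑ ≤ ‖z - w‖ₑ * cauchyWeightNorm F μ := by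
  refine (enorm_integral_le_lintegral_enorm _).trans ?_
  simp only [enorm_mul, μ.enorm_phase, mul_one]
  exact lintegral_cauchyKernel_sub_le hz hw

theorem continuousOn_modifiedCauchyIntegral (hμ : cauchyWeightNorm F μ < ∞) {z₀ : ℂ}
    (hz₀ : z₀ ∈ F) : ContinuousOn (modifiedCauchyIntegral F μ z₀) F := by
  refine LipschitzOnWith.continuousOn (K := (cauchyWeightNorm F μ).toNNReal) fun z hz w hw => ?_
  rw [edist_eq_enorm_sub, edist_eq_enorm_sub, ENNReal.coe_toNNReal hμ.ne,
    modifiedCauchyIntegral_sub hμ hz₀ hz hw, mul_comm]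
  exact enorm_modifiedCauchyIntegral_le hz hw

/-! ### Resolvents of `N` integrated against `μ`. -/

variable {H : Type*} [NormedAddCommGroup H] [InnerProductSpace ℂ H]
  {N : H →L[ℂ] H}

theorem continuousOn_cauchyKernel (hσ : spectrum ℂ N ⊆ F) (ζ : ↥Fᶜ) :
    ContinuousOn (fun z => 1 / ((ζ : ℂ) - z)) (spectrum ℂ N) :=
  continuousOn_const.div (by fun_prop) fun _ hz => coe_compl_sub_ne_zero ζ (hσ hz)

variable [CompleteSpace H]

theorem aemeasurable_enorm_cfc_cauchyKernel_apply (hN : IsStarNormal N)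
    (hσ : spectrum ℂ N ⊆ F) (u : H) :
    AEMeasurable (fun ζ : ↥Fᶜ => ‖cfc (fun z => 1 / ((ζ : ℂ) - z)) N u‖ₑ) μ.variation := by
  obtain ⟨ν, hν, hνu⟩ := exists_scalar_spectralMeasure hN u
  -- The square is a parameter integral of a jointly measurable kernel; a square root follows.
  have h : Measurable fun ζ : ↥Fᶜ => ‖cfc (fun z => 1 / ((ζ : ℂ) - z)) N u‖ₑ ^ (2 : ℝ) := by
    simp_rw [ENNReal.rpow_two, enorm_cfc_apply_sq hνu (continuousOn_cauchyKernel hσ _)]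
    refine Measurable.lintegral_prod_right' (f := fun p : ↥Fᶜ × spectrum ℂ N =>
      ‖1 / ((p.1 : ℂ) - p.2)‖ₑ ^ 2) (by fun_prop)
  have h' := h.pow_const (1 / 2 : ℝ)
  simp_rw [← ENNReal.rpow_mul] at h'
  norm_num at h'
  simpa using h'.aemeasurable

theorem lintegral_enorm_cfc_cauchyKernel_apply_sq_le (hF : IsClosed F) (hN : IsStarNormal N)
    (hσ : spectrum ℂ N ⊆ F) (u : H) :
    ∫⁻ ζ : ↥Fᶜ, ‖cfc (fun z => 1 / ((ζ : ℂ) - z)) N u‖ₑ ^ 2 ∂μ.variation ≤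
      cauchyWeightNorm F μ * ‖u‖ₑ ^ 2 := by
  have := μ.sigmaFinite_variation hF
  obtain ⟨ν, hν, hνu⟩ := exists_scalar_spectralMeasure hN u
  -- The isometry formula at `g = 1`.
  have hu : ‖u‖ₑ ^ 2 = ν Set.univ := by
    have h := enorm_cfc_apply_sq hνu (g := fun _ => 1) continuousOn_const
    rw [cfc_const_one ℂ N] at h
    simpa using h
  simp_rw [enorm_cfc_apply_sq hνu (continuousOn_cauchyKernel hσ _)]
  rw [lintegral_lintegral_swap (by fun_prop), hu, ← lintegral_const]
  exact lintegral_mono fun z => lintegral_cauchyKernel_sq_le (hσ z.2)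

/-- Fubini for `|μ|` and `ν`: absolute integrability holds because `|z - z₀|` is bounded on the
compact spectrum. -/
theorem integrable_and_integral_inner_self_cfc (hF : IsClosed F) (hμ : cauchyWeightNorm F μ < ∞)
    {z₀ : ℂ} (hz₀ : z₀ ∈ F) (hN : IsStarNormal N) (hσ : spectrum ℂ N ⊆ F) (u : H) :
    Integrable (fun ζ : ↥Fᶜ =>
      ⟪u, cfc (fun z => 1 / ((ζ : ℂ) - z) - 1 / ((ζ : ℂ) - z₀)) N u⟫_ℂ * μ.phase ζ) μ.variation ∧
    ∫ ζ : ↥Fᶜ, ⟪u, cfc (fun z => 1 / ((ζ : ℂ) - z) - 1 / ((ζ : ℂ) - z₀)) N u⟫_ℂ * μ.phase ζ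
      ∂μ.variation = ⟪u, cfc (modifiedCauchyIntegral F μ z₀) N u⟫_ℂ := by
  have := μ.sigmaFinite_variation hF
  have hph := μ.measurable_phase
  obtain ⟨ν, hν, hνu⟩ := exists_scalar_spectralMeasure hN u
  have hint : Integrable (fun p : ↥Fᶜ × spectrum ℂ N =>
      (1 / ((p.1 : ℂ) - p.2) - 1 / ((p.1 : ℂ) - z₀)) * μ.phase p.1) (μ.variation.prod ν) := by
    refine ⟨by fun_prop, ?_⟩
    rw [HasFiniteIntegral, lintegral_prod_symm _ (by fun_prop)]
    simp only [enorm_mul, μ.enorm_phase, mul_one]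
    calc _ ≤ ∫⁻ z : spectrum ℂ N, ‖(z : ℂ) - z₀‖ₑ * cauchyWeightNorm F μ ∂ν :=
          lintegral_mono fun z => lintegral_cauchyKernel_sub_le (hσ z.2) hz₀
      _ = (∫⁻ z : spectrum ℂ N, ‖(z : ℂ) - z₀‖ₑ ∂ν) * cauchyWeightNorm F μ :=
          lintegral_mul_const _ (by fun_prop)
      _ < ∞ := by
          refine ENNReal.mul_lt_top ?_ hμ
          have hc : Continuous fun z : spectrum ℂ N => (z : ℂ) - z₀ := by fun_prop
          exact (hc.integrable_of_hasCompactSupport (HasCompactSupport.of_compactSpace _)).2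
  have heq (ζ : ↥Fᶜ) :
      ⟪u, cfc (fun z => 1 / ((ζ : ℂ) - z) - 1 / ((ζ : ℂ) - z₀)) N u⟫_ℂ * μ.phase ζ =
        ∫ z : spectrum ℂ N, (1 / ((ζ : ℂ) - z) - 1 / ((ζ : ℂ) - z₀)) * μ.phase ζ ∂ν := by
    rw [hνu (fun z => 1 / ((ζ : ℂ) - z) - 1 / ((ζ : ℂ) - z₀))
      ((continuousOn_cauchyKernel hσ ζ).sub continuousOn_const), integral_mul_const]
  simp_rw [heq]
  refine ⟨hint.integral_prod_left, ?_⟩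
  rw [integral_integral_swap hint,
    hνu _ ((continuousOn_modifiedCauchyIntegral hμ hz₀).mono hσ)]
  rfl

theorem integrable_and_integral_inner_cfc (hF : IsClosed F) (hμ : cauchyWeightNorm F μ < ∞)
    {z₀ : ℂ} (hz₀ : z₀ ∈ F) (hN : IsStarNormal N) (hσ : spectrum ℂ N ⊆ F) (v u : H) :
    Integrable (fun ζ : ↥Fᶜ =>
      ⟪v, cfc (fun z => 1 / ((ζ : ℂ) - z) - 1 / ((ζ : ℂ) - z₀)) N u⟫_ℂ * μ.phase ζ) μ.variation ∧
    ∫ ζ : ↥Fᶜ, ⟪v, cfc (fun z => 1 / ((ζ : ℂ) - z) - 1 / ((ζ : ℂ) - z₀)) N u⟫_ℂ * μ.phase ζ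
      ∂μ.variation = ⟪v, cfc (modifiedCauchyIntegral F μ z₀) N u⟫_ℂ := by
  have h := integrable_and_integral_inner_self_cfc hF hμ hz₀ hN hσ
  obtain ⟨i1, e1⟩ := h (v + u)
  obtain ⟨i2, e2⟩ := h (v - u)
  obtain ⟨i3, e3⟩ := h (v + Complex.I • u)
  obtain ⟨i4, e4⟩ := h (v - Complex.I • u)
  have hpol (ζ : ↥Fᶜ) := congrArg (· * μ.phase ζ) (inner_polarization_right
    (cfc (fun z => 1 / ((ζ : ℂ) - z) - 1 / ((ζ : ℂ) - z₀)) N) v u)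
  simp only [div_mul_eq_mul_div, add_mul, sub_mul, mul_assoc] at hpol
  simp_rw [hpol]
  have j3 := i3.const_mul Complex.I
  have j4 := i4.const_mul Complex.I
  refine ⟨(((i1.sub i2).sub j3).add j4).div_const 4, ?_⟩
  have i12 := integral_sub i1 i2
  have i123 := integral_sub (i1.sub i2) j3
  have i1234 := integral_add ((i1.sub i2).sub j3) j4
  simp only [Pi.sub_apply] at i123 i1234
  rw [integral_div, i1234, i123, i12, integral_const_mul, integral_const_mul, e1, e2, e3, e4,
    inner_polarization_right _ v u]

theorem cfc_cauchyKernel_sub_commutator (hN : IsStarNormal N) (hσ : spectrum ℂ N ⊆ F)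
    (ζ : ↥Fᶜ) (z₀ : ℂ) (R : H →L[ℂ] H) :
    cfc (fun z => 1 / ((ζ : ℂ) - z) - 1 / ((ζ : ℂ) - z₀)) N * R -
        R * cfc (fun z => 1 / ((ζ : ℂ) - z) - 1 / ((ζ : ℂ) - z₀)) N =
      cfc (fun z => 1 / ((ζ : ℂ) - z)) N * (N * R - R * N) *
        cfc (fun z => 1 / ((ζ : ℂ) - z)) N := by
  have hc := continuousOn_cauchyKernel hσ ζ
  rw [cfc_sub _ _ N hc continuousOn_const, cfc_const _ N]
  set G := cfc (fun z => 1 / ((ζ : ℂ) - z)) N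
  have hlin : cfc (fun z => (ζ : ℂ) - z) N = algebraMap ℂ _ (ζ : ℂ) - N := by
    rw [cfc_sub _ _ N continuousOn_const (continuousOn_id' _), cfc_const _ N, cfc_id' ℂ N]
  have hl : G * (algebraMap ℂ _ (ζ : ℂ) - N) = 1 := by
    rw [← hlin, ← cfc_mul _ _ N hc (by fun_prop), ← cfc_const_one ℂ N]
    exact cfc_congr fun z hz => one_div_mul_cancel (coe_compl_sub_ne_zero ζ (hσ hz))
  have hr : (algebraMap ℂ _ (ζ : ℂ) - N) * G = 1 := by
    rw [← hlin, ← cfc_mul _ _ N (by fun_prop) hc, ← cfc_const_one ℂ N]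
    exact cfc_congr fun z hz => mul_one_div_cancel (coe_compl_sub_ne_zero ζ (hσ hz))
  have hcomm (a : ℂ) := Algebra.commutes a R
  -- The scalar `1 / (ζ - z₀)` commutes with `R` and drops out.
  calc _ = G * R - R * G := by rw [sub_mul, mul_sub, hcomm]; abel
    _ = G * (R * ((algebraMap ℂ _ (ζ : ℂ) - N) * G)) -
        (G * (algebraMap ℂ _ (ζ : ℂ) - N)) * (R * G) := by rw [hl, hr, mul_one, one_mul]
    _ = G * (R * (algebraMap ℂ _ (ζ : ℂ) - N) - (algebraMap ℂ _ (ζ : ℂ) - N) * R) * G := by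
      noncomm_ring
    _ = _ := by rw [mul_sub R, sub_mul _ _ R, hcomm]; congr 2; abel

theorem norm_cfc_modifiedCauchyIntegral_commutator_le (hF : IsClosed F)
    (hμ : cauchyWeightNorm F μ < ∞) {z₀ : ℂ} (hz₀ : z₀ ∈ F) (hN : IsStarNormal N)
    (hσ : spectrum ℂ N ⊆ F) (R : H →L[ℂ] H) :
    ‖cfc (modifiedCauchyIntegral F μ z₀) N * R - R * cfc (modifiedCauchyIntegral F μ z₀) N‖ ≤
      (cauchyWeightNorm F μ).toReal * ‖N * R - R * N‖ := by
  refine ContinuousLinearMap.opNorm_le_of_re_inner_le (by positivity) fun u v hu hv => ?_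
  set T := modifiedCauchyIntegral F μ z₀
  set D := N * R - R * N
  obtain ⟨i1, e1⟩ := integrable_and_integral_inner_cfc hF hμ hz₀ hN hσ v (R u)
  -- Moving `R` to the left argument turns `R * cfc T N` into a matrix coefficient of `cfc T N`.
  obtain ⟨i2, e2⟩ := integrable_and_integral_inner_cfc hF hμ hz₀ hN hσ
    (ContinuousLinearMap.adjoint R v) u
  have hrep : ⟪v, (cfc T N * R - R * cfc T N) u⟫_ℂ = ∫ ζ : ↥Fᶜ,
      ⟪v, (cfc (fun z => 1 / ((ζ : ℂ) - z)) N * D * cfc (fun z => 1 / ((ζ : ℂ) - z)) N) u⟫_ℂ *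
        μ.phase ζ ∂μ.variation := by
    rw [sub_apply, mul_apply_eq_comp, mul_apply_eq_comp, inner_sub_right,
      ← ContinuousLinearMap.adjoint_inner_left R, ← e1, ← e2, ← integral_sub i1 i2]
    refine integral_congr_ae (.of_forall fun ζ => ?_)
    simp only
    rw [← cfc_cauchyKernel_sub_commutator hN hσ ζ z₀ R, sub_apply, mul_apply_eq_comp,
      mul_apply_eq_comp, inner_sub_right, ← ContinuousLinearMap.adjoint_inner_left R, sub_mul]
  have hbound : ‖⟪v, (cfc T N * R - R * cfc T N) u⟫_ℂ‖ₑ ≤ cauchyWeightNorm F μ * ‖D‖ₑ := by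
    have hu' : ‖u‖ₑ = 1 := by rw [← ofReal_norm, hu, ENNReal.ofReal_one]
    have hv' : ‖v‖ₑ = 1 := by rw [← ofReal_norm, hv, ENNReal.ofReal_one]
    have hm := aemeasurable_enorm_cfc_cauchyKernel_apply (μ := μ) hN hσ
    have hL := lintegral_enorm_cfc_cauchyKernel_apply_sq_le (μ := μ) hF hN hσ
    rw [hrep]
    calc _ ≤ _ := enorm_integral_le_lintegral_enorm _
      _ ≤ ∫⁻ ζ : ↥Fᶜ, (‖cfc (fun z => 1 / ((ζ : ℂ) - z)) N v‖ₑ *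
            ‖cfc (fun z => 1 / ((ζ : ℂ) - z)) N u‖ₑ) * ‖D‖ₑ ∂μ.variation := by
          refine lintegral_mono fun ζ => ?_
          rw [enorm_mul, μ.enorm_phase, mul_one, mul_apply_eq_comp, mul_apply_eq_comp,
            ← ContinuousLinearMap.adjoint_inner_left]
          set G := cfc (fun z => 1 / ((ζ : ℂ) - z)) N
          have hG : IsStarNormal G := cfc_predicate _ _
          have hGv : ‖G v‖ₑ = ‖ContinuousLinearMap.adjoint G v‖ₑ := by
            rw [← ofReal_norm, ← ofReal_norm,
              ContinuousLinearMap.isStarNormal_iff_norm_eq_adjoint.mp hG v]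
          rw [hGv]
          simp only [← ofReal_norm]
          rw [← ENNReal.ofReal_mul (norm_nonneg _), ← ENNReal.ofReal_mul (by positivity)]
          refine ENNReal.ofReal_le_ofReal ((norm_inner_le_norm _ _).trans ?_)
          rw [mul_assoc, mul_comm ‖G u‖]
          gcongr
          exact D.le_opNorm _
      _ = (∫⁻ ζ : ↥Fᶜ, ‖cfc (fun z => 1 / ((ζ : ℂ) - z)) N v‖ₑ *
            ‖cfc (fun z => 1 / ((ζ : ℂ) - z)) N u‖ₑ ∂μ.variation) * ‖D‖ₑ :=
          lintegral_mul_const'' _ ((hm v).mul (hm u))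
      _ ≤ _ := by
          gcongr
          exact lintegral_mul_le_of_lintegral_sq_le (hm v) (hm u)
            (by simpa [hv'] using hL v) (by simpa [hu'] using hL u)
  have hbound' := ENNReal.toReal_mono (ENNReal.mul_ne_top hμ.ne (by simp)) hbound
  rw [ENNReal.toReal_mul, toReal_enorm, toReal_enorm] at hbound'
  refine ((Complex.re_le_norm _).trans_eq ?_).trans hbound'
  exact norm_inner_symm _ _

theorem IsCauchyRepresentation.isCommutatorLipschitzWith (hF : IsClosed F) {z₀ : ℂ}
    (hz₀ : z₀ ∈ F) {f : ℂ → ℂ} (h : IsCauchyRepresentation F z₀ f μ) :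
    IsCommutatorLipschitzWith.{u} F (cauchyWeightNorm F μ).toNNReal f := by
  obtain ⟨hμ, c, hc⟩ := h
  have hcont := continuousOn_modifiedCauchyIntegral hμ hz₀
  refine ⟨(continuousOn_const.add hcont).congr hc, fun H _ _ _ N R hN hσ => ?_⟩
  have hf : cfc f N = algebraMap ℂ _ c + cfc (modifiedCauchyIntegral F μ z₀) N := by
    rw [cfc_congr (a := N) (fun z hz => hc z (hσ hz)),
      cfc_const_add c _ N (hcont.mono hσ)]
  rw [hf, add_mul, mul_add, Algebra.commutes c R, add_sub_add_left_eq_sub]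
  exact norm_cfc_modifiedCauchyIntegral_commutator_le hF hμ hz₀ hN hσ R

end CauchyIntegral

theorem mainTheorem11 (F : Set ℂ) (hF : IsClosed F) (hF' : F ≠ Set.univ) (z₀ : ℂ) (hz₀ : z₀ ∈ F) :
    CauchyClass F z₀ ⊆ CommutatorLipschitz.{u} F ∧
      ∀ f ∈ CauchyClass F z₀, commutatorLipschitzNorm.{u} F f ≤ cauchyClassNorm F z₀ f := by
  refine ⟨fun f ⟨μ, hμ⟩ => ⟨_, hμ.isCommutatorLipschitzWith hF hz₀⟩,
    fun f _ => le_iInf₂ fun μ hμ => ?_⟩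
  calc commutatorLipschitzNorm.{u} F f ≤ ((cauchyWeightNorm F μ).toNNReal : ℝ≥0∞) :=
        iInf₂_le (f := fun (C : ℝ≥0) _ => (C : ℝ≥0∞)) _
          (hμ.isCommutatorLipschitzWith hF hz₀)
    _ = cauchyWeightNorm F μ := ENNReal.coe_toNNReal hμ.1.ne
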